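/- **Theorem 4.9.** Let $R$ be an associative ring with identity and let $A=\sigma(R)\langle x_1,\dots,x_n\rangle$ be a *bijective skew PBW extension* of $R$. That is, $R$ is a subring of the ring $A$ (with the same identity), and $x_1,\dots,x_n\in A$ are elements such that: - the standard monomials $x^\alpha:=x_1^{\alpha_1}\cdots x_n^{\alpha_n}$ ($\alpha\in\mathbb N^n$) form a basis of $A$ as a left $R$-module; - for all $i$ and all $0\ne r\in R$ there is $0\neq c_{i,r}\in R$ with $x_ir-c_{i,r}x_i\in R$; - for all $i,j$ there is $0\ne d_{i,j}\in R$ with $x_jx_i-d_{i,j}x_ix_j\in R+Rx_1+\cdots+Rx_n$; - writing $x_ir=\sigma_i(r)x_i+\delta_i(r)$ with $\sigma_i(r),\delta_i(r)\in R$, each map $\sigma_i:R\to R$ is bijective, and $d_{i,j}$ is invertible for all $i<j$. Let $M_R$ be a right $R$-module, and let $M\langle X\rangle_A=M\otimes_RA$ be the induced right $A$-module. Its elements are the finite formal sums $\sum_\alpha m_\alpha x^\alpha$ with $m_\alpha\in M$, and the action is the additive one with $(mx^\alpha)a=\sum_\beta (m r_\beta)x^\beta$ when $x^\alpha a=\sum_\beta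 r_\beta x^\beta$ in $A$. Fix a total order $\preceq$ on the monomials such that $x^\alpha\prec x^\beta$ whenever $\alpha_1+\cdots+\alpha_n<\beta_1+\cdots+\beta_n$. For $0\ne f\in M\langle X\rangle_A$ let $\mathrm{lm}(f)$ be the largest monomial with non-zero coefficient in $f$. A non-zero $f$ is called a *good polynomial* if $\mathrm{lm}(fr)=\mathrm{lm}(f)$ for every $r\in R$ with $fr\neq0$. The module $M\langle X\rangle_A$ is called *good* if for every good polynomial $f\in M\langle X\rangle_A$, with $\mathrm{lm}(f)=x^{\alpha}$, and every $\gamma\in\mathbb N^n$ there is a good polynomial $g\in fA$ with $\mathrm{lm}(g)=x^{\alpha+\gamma}$. The uniform dimension $\mathrm{udim}(N)$ of a module $N$ is the number $k\in\mathbb N$ such that $N$ contains $k$ uniform submodules whose sum is direct and essential in $N$, and it is $\infty$ if there is no such $k$. (A submodule is uniform if it is non-zero and any two of its non-zero submodules intersect non-trivially.) If $M\langle X\rangle_A$ is good, then $$\mathrm{udim}(M\langle X\rangle_A)=\mathrm{udim}(M_R)\in\mathbb N\cup\{\infty\}.$$ -/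

import Mathlib

/-! ### Uniform dimension of a module -/

section UniformDimension

/-- A submodule `U` of `N` is essential if every non-zero cyclic submodule of `N` meets it
non-trivially. -/
def IsEssentialSubmodule {S N : Type*} [Ring S] [AddCommGroup N] [Module S N]
    (U : Submodule S N) : Prop :=
  ∀ m : N, m ≠ 0 → Submodule.span S {m} ⊓ U ≠ ⊥

/-- A submodule `U` of `N` is uniform if it is non-zero and any two non-zero submodules of `U`
have non-zero intersection. -/
def IsUniformSubmodule {S N : Type*} [Ring S] [AddCommGroup N] [Module S N]
    (U : Submodule S N) : Prop :=
  U ≠ ⊥ ∧ ∀ V W : Submodule S N, V ≤ U → W ≤ U → V ≠ ⊥ → W ≠ ⊥ → V ⊓ W ≠ ⊥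

/-- `N` contains `k` uniform submodules whose sum is direct and essential in `N`. -/
def HasUniformDimension (S N : Type*) [Ring S] [AddCommGroup N] [Module S N] (k : ℕ) : Prop :=
  ∃ U : Fin k → Submodule S N,
    (∀ i, IsUniformSubmodule (U i)) ∧ iSupIndep U ∧ IsEssentialSubmodule (⨆ i, U i)

/-- The uniform dimension of `N`: the number `k` (unique if it exists) such that `N` contains `k`
uniform submodules whose sum is direct and essential, and `∞` if there is no such `k`. -/
noncomputable def uniformDimension (S N : Type*) [Ring S] [AddCommGroup N] [Module S N] : ℕ∞ :=
  ⨅ (k : ℕ) (_ : HasUniformDimension S N k), (k : ℕ∞)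

end UniformDimension

/-! ### Skew PBW extensions -/

section SkewPBW

/-- The standard monomial `x₁ ^ α₁ * ⋯ * xₙ ^ αₙ` (the product is taken in this order). -/
def stdMonomial {A : Type*} [Ring A] {n : ℕ} (x : Fin n → A) (α : Fin n → ℕ) : A :=
  (List.ofFn fun i => x i ^ α i).prod

/-- The ring `A` is a skew PBW extension of its subring `R` in the elements `x₁, …, xₙ`. -/
structure IsSkewPBWExtension {A : Type*} [Ring A] (R : Subring A) {n : ℕ} (x : Fin n → A) :
    Prop where
  /-- the standard monomials are left linearly independent over `R` -/
  linearIndependent : LinearIndependent R (stdMonomial x)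
  /-- the standard monomials generate `A` as a left `R`-module -/
  span_eq_top : Submodule.span R (Set.range (stdMonomial x)) = ⊤
  coeff_rel : ∀ (i : Fin n) (r : R), r ≠ 0 →
    ∃ c : R, c ≠ 0 ∧ x i * (r : A) - (c : A) * x i ∈ R
  var_rel : ∀ i j : Fin n, ∃ d : R, d ≠ 0 ∧ ∃ (r₀ : R) (r : Fin n → R),
    x j * x i - (d : A) * x i * x j = (r₀ : A) + ∑ k, (r k : A) * x k

/-- A bijective skew PBW extension: the maps `σᵢ` determined by `xᵢ r = σᵢ(r) xᵢ + δᵢ(r)` are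
bijective, and the elements `d i j` with `xⱼ xᵢ - d i j xᵢ xⱼ ∈ R + R x₁ + ⋯ + R xₙ` are
invertible for `i < j`.  As the standard monomials form a basis, `σᵢ`, `δᵢ` and these `d i j` are
uniquely determined, so the existential quantifiers below are harmless. -/
structure IsBijectiveSkewPBWExtension {A : Type*} [Ring A] (R : Subring A) {n : ℕ}
    (x : Fin n → A) : Prop extends IsSkewPBWExtension R x where
  sigma_bijective : ∀ i : Fin n, ∃ σ δ : R → R,
    (∀ r : R, x i * (r : A) = (σ r : A) * x i + (δ r : A)) ∧ Function.Bijective σ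
  d_isUnit : ∀ i j : Fin n, i < j → ∃ d : R, IsUnit d ∧ ∃ (r₀ : R) (r : Fin n → R),
    x j * x i - (d : A) * x i * x j = (r₀ : A) + ∑ k, (r k : A) * x k

/-- The left `R`-basis of `A` formed by the standard monomials. -/
noncomputable def IsSkewPBWExtension.basis {A : Type*} [Ring A] {R : Subring A} {n : ℕ}
    {x : Fin n → A} (h : IsSkewPBWExtension R x) : Module.Basis (Fin n → ℕ) R A :=
  Module.Basis.mk h.linearIndependent h.span_eq_top.ge

end SkewPBW

/-! ### The induced module

Right modules over a ring are modules over the opposite ring: `m r` is `MulOpposite.op r • m`. -/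

section InducedModule

/-- The induced module `M⟨X⟩` of a right `R`-module `M`: the formal sums `∑ mₐ x^α` with
coefficients in `M`, encoded by the finitely supported families `α ↦ mₐ`. -/
def InducedModule {A : Type*} [Ring A] {R : Subring A} {n : ℕ} {x : Fin n → A}
    (_h : IsSkewPBWExtension R x) (M : Type*) [AddCommGroup M] : Type _ :=
  (Fin n → ℕ) →₀ M

namespace InducedModule

variable {A : Type*} [Ring A] {R : Subring A} {n : ℕ} {x : Fin n → A}

noncomputable instance (h : IsSkewPBWExtension R x) (M : Type*) [AddCommGroup M] :
    AddCommGroup (InducedModule h M) :=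
  inferInstanceAs (AddCommGroup ((Fin n → ℕ) →₀ M))

/-- For `m` in `M` and `a = ∑ r_β x^β` in `A`, the element `∑ (m r_β) x^β` of `M⟨X⟩`. -/
noncomputable def tmul (h : IsSkewPBWExtension R x) (M : Type*) [AddCommGroup M]
    [Module (↥R)ᵐᵒᵖ M] : M →+ A →+ ((Fin n → ℕ) →₀ M) where
  toFun m :=
    { toFun := fun a =>
        (h.basis.repr a).mapRange (fun r : R => MulOpposite.op r • m) (by simp)
      map_zero' := by ext; simp
      map_add' := fun a b => by ext; simp [add_smul] }
  map_zero' := by ext; simp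
  map_add' m m' := by ext; simp

/-- The right multiplication of `M⟨X⟩` by an element `a` of `A`: the additive map that sends
`m x^α` to `∑ (m r_β) x^β`, where `x^α a = ∑ r_β x^β` in `A`. -/
noncomputable def mulRight (h : IsSkewPBWExtension R x) (M : Type*) [AddCommGroup M]
    [Module (↥R)ᵐᵒᵖ M] (a : A) : ((Fin n → ℕ) →₀ M) →+ ((Fin n → ℕ) →₀ M) :=
  Finsupp.liftAddHom fun α => (tmul h M).flip (stdMonomial x α * a)

theorem tmul_apply (h : IsSkewPBWExtension R x) (M : Type*) [AddCommGroup M]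
    [Module (↥R)ᵐᵒᵖ M] (m : M) (a : A) (β : Fin n → ℕ) :
    tmul h M m a β = MulOpposite.op (h.basis.repr a β) • m := rfl

theorem mulRight_single (h : IsSkewPBWExtension R x) (M : Type*) [AddCommGroup M]
    [Module (↥R)ᵐᵒᵖ M] (a : A) (α : Fin n → ℕ) (m : M) :
    mulRight h M a (Finsupp.single α m) = tmul h M m (stdMonomial x α * a) := by
  simp [mulRight]

theorem tmul_smul (h : IsSkewPBWExtension R x) (M : Type*) [AddCommGroup M]
    [Module (↥R)ᵐᵒᵖ M] (m : M) (r : R) (a : A) :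
    tmul h M m (r • a) = tmul h M (MulOpposite.op r • m) a := by
  ext β
  simp [tmul_apply, mul_smul]

theorem tmul_stdMonomial (h : IsSkewPBWExtension R x) (M : Type*) [AddCommGroup M]
    [Module (↥R)ᵐᵒᵖ M] (m : M) (α : Fin n → ℕ) :
    tmul h M m (stdMonomial x α) = Finsupp.single α m := by
  classical
  have hb : stdMonomial x α = h.basis α := by simp [IsSkewPBWExtension.basis]
  ext β
  rw [tmul_apply, hb, Module.Basis.repr_self, Finsupp.single_apply, Finsupp.single_apply]
  split_ifs <;> simp

theorem mulRight_tmul (h : IsSkewPBWExtension R x) (M : Type*) [AddCommGroup M]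
    [Module (↥R)ᵐᵒᵖ M] (m : M) (a b : A) :
    mulRight h M b (tmul h M m a) = tmul h M m (a * b) := by
  have ha : a ∈ Submodule.span R (Set.range (stdMonomial x)) := by
    rw [h.span_eq_top]; trivial
  induction ha using Submodule.span_induction generalizing m with
  | mem a ha =>
    obtain ⟨α, rfl⟩ := ha
    rw [tmul_stdMonomial, mulRight_single]
  | zero => simp
  | add a c _ _ iha ihc => rw [map_add, map_add, iha, ihc, add_mul, map_add]
  | smul r a _ ih => rw [tmul_smul, ih, smul_mul_assoc, tmul_smul]

/-- The right `A`-module structure of `M⟨X⟩`. -/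
noncomputable instance (h : IsSkewPBWExtension R x) (M : Type*) [AddCommGroup M]
    [Module (↥R)ᵐᵒᵖ M] : Module Aᵐᵒᵖ (InducedModule h M) where
  smul a f := mulRight h M a.unop f
  one_smul f := by
    change mulRight h M 1 f = f
    induction f using Finsupp.induction_linear with
    | zero => exact map_zero _
    | add f g hf hg => exact (map_add _ f g).trans (congrArg₂ _ hf hg)
    | single α m => rw [mulRight_single, mul_one, tmul_stdMonomial]
  mul_smul a b f := by
    change mulRight h M (b.unop * a.unop) f = mulRight h M a.unop (mulRight h M b.unop f)
    induction f using Finsupp.induction_linear with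
    | zero => simp
    | add f g hf hg => rw [map_add, map_add, map_add, hf, hg]
    | single α m => rw [mulRight_single, mulRight_single, mulRight_tmul, mul_assoc]
  smul_zero a := map_zero (mulRight h M a.unop)
  smul_add a := map_add (mulRight h M a.unop)
  add_smul a b f := by
    change mulRight h M (a.unop + b.unop) f = mulRight h M a.unop f + mulRight h M b.unop f
    induction f using Finsupp.induction_linear with
    | zero => simp
    | add f g hf hg => rw [map_add, map_add, map_add, hf, hg]; abel
    | single α m => simp only [mulRight_single, mul_add, map_add]
  zero_smul f := by
    change mulRight h M 0 f = 0
    induction f using Finsupp.induction_linear with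
    | zero => simp
    | add f g hf hg => rw [map_add, hf, hg, add_zero]
    | single α m => rw [mulRight_single, mul_zero, map_zero]

/-- `x^α` is the leading monomial of `f` with respect to the total order `le` on the exponents:
it occurs in `f` and is the largest monomial that does. -/
def IsLeadingMonomial {h : IsSkewPBWExtension R x} {M : Type*} [AddCommGroup M]
    (le : (Fin n → ℕ) → (Fin n → ℕ) → Prop) (f : InducedModule h M) (α : Fin n → ℕ) : Prop :=
  α ∈ Finsupp.support f ∧ ∀ β ∈ Finsupp.support f, le β α

/-- A non-zero `f` in `M⟨X⟩` is a good polynomial if `f r` has the same leading monomial as `f`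
for every `r` in `R` with `f r ≠ 0`. -/
def IsGoodPolynomial {h : IsSkewPBWExtension R x} {M : Type*} [AddCommGroup M]
    [Module (↥R)ᵐᵒᵖ M] (le : (Fin n → ℕ) → (Fin n → ℕ) → Prop) (f : InducedModule h M) : Prop :=
  ∃ α, IsLeadingMonomial le f α ∧
    ∀ r : R, MulOpposite.op (r : A) • f ≠ 0 →
      IsLeadingMonomial le (MulOpposite.op (r : A) • f) α

/-- A submodule `B` of `M⟨X⟩` is good if, for every good polynomial `f` in `B`, say with leading
monomial `x^α`, and every multiple `x^(α + γ)` of this monomial, the cyclic submodule `f A`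
contains a good polynomial with leading monomial `x^(α + γ)`. -/
def IsGoodSubmodule {h : IsSkewPBWExtension R x} {M : Type*} [AddCommGroup M]
    [Module (↥R)ᵐᵒᵖ M] (le : (Fin n → ℕ) → (Fin n → ℕ) → Prop)
    (B : Submodule Aᵐᵒᵖ (InducedModule h M)) : Prop :=
  ∀ f ∈ B, IsGoodPolynomial le f → ∀ α, IsLeadingMonomial le f α → ∀ γ : Fin n → ℕ,
    ∃ g ∈ Submodule.span Aᵐᵒᵖ {f}, IsGoodPolynomial le g ∧ IsLeadingMonomial le g (α + γ)

end InducedModule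

end InducedModule

/-! Uniform dimension is measured by independent families: by `uniformDimension_le_iff`, it is at
most `k` exactly when no independent family of non-zero elements has more than `k` members. So it
suffices to compare the sizes of such families in `M` over `R` and in `M⟨X⟩` over `A`.

An independent family in `M` stays independent over `A` when viewed as constants
(`indepElems_const`).

The converse is a growth argument. Let `v` be an independent family of `m` elements of `M⟨X⟩` and
let `M` have rank at most `d`. Multiplying by scalars makes every `v i` good
(`exists_smul_isGoodPolynomial`). Goodness of the module then gives, for a fixed exponent `α` and
every `γ`, a good polynomial in each `v i A` with leading monomial `x^(α + γ)`. Those with `γ` of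
degree at most `k` are independent over `R`: across different `i` because `v` is, and for one `i`
because their leading monomials differ (`indepElems_of_isGoodPolynomial`). They lie in the elements
of degree at most `k + |α|`, whose rank over `R` is at most `d` times the number of exponents there
(`rankLE_supportedIn`). Hence `m * |B k| ≤ |B (k + |α|)| * d` for all `k`, where `B k` is the degree
ball. As `|B k|` grows polynomially, `m ≤ d` (`le_of_card_degreeBall`). -/

/-! ### Independent families of elements -/

section IndependentElements

variable {S N : Type*} [Ring S] [AddCommGroup N] [Module S N]

/-- The cyclic submodules generated by the members of the family `v` form a direct sum. -/
def IndepElems (S : Type*) {N ι : Type*} [Ring S] [AddCommGroup N] [Module S N] [Fintype ι]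
    (v : ι → N) : Prop :=
  ∀ c : ι → S, ∑ i, c i • v i = 0 → ∀ i, c i • v i = 0

/-- Every finite independent family of non-zero elements of `U` has at most `d` members. -/
def RankLE (U : Submodule S N) (d : ℕ) : Prop :=
  ∀ (ι : Type) [Fintype ι] (v : ι → N), (∀ i, v i ∈ U) → (∀ i, v i ≠ 0) → IndepElems S v →
    Fintype.card ι ≤ d

theorem RankLE.mono {U : Submodule S N} {d e : ℕ} (hU : RankLE U d) (hde : d ≤ e) :
    RankLE U e :=
  fun ι _ v h₁ h₂ h₃ => (hU ι v h₁ h₂ h₃).trans hde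

theorem IndepElems.smul {ι : Type*} [Fintype ι] {v : ι → N} (hv : IndepElems S v) (d : ι → S) :
    IndepElems S fun i => d i • v i := by
  intro c hc i
  simp only [smul_smul] at hc ⊢
  exact hv (fun i => c i * d i) hc i

theorem IndepElems.sum_finset {ι : Type*} [Fintype ι] {v : ι → N} (hv : IndepElems S v)
    (s : Finset ι) (c : ι → S) (hc : ∑ i ∈ s, c i • v i = 0) (i : ι) (hi : i ∈ s) :
    c i • v i = 0 := by
  classical
  have := hv (fun i => if i ∈ s then c i else 0) (by simpa [ite_smul] using hc) i
  simpa [hi] using this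

/-- A finite independent family splits, relative to a submodule `K`, into a part whose span meets
`K` trivially and a part which can be replaced by an independent family in `K`. -/
theorem IndepElems.exists_split {ι : Type*} [Fintype ι] [DecidableEq ι] {v : ι → N} (hv : IndepElems S v)
    (K : Submodule S N) :
    ∃ s : Finset ι, (∀ c : ι → S, ∑ i ∈ s, c i • v i ∈ K → ∑ i ∈ s, c i • v i = 0) ∧
      ∃ w : {i // i ∉ s} → N, (∀ i, w i ∈ K) ∧ (∀ i, w i ≠ 0) ∧ IndepElems S w := by
  let p : Finset ι → Prop := fun s =>
    ∀ c : ι → S, ∑ i ∈ s, c i • v i ∈ K → ∑ i ∈ s, c i • v i = 0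
  have hex : ({s | p s} : Set (Finset ι)).Nonempty := ⟨∅, by simp [p]⟩
  obtain ⟨s, hs, hmax⟩ := (Set.toFinite {s | p s}).exists_maximal hex
  refine ⟨s, hs, ?_⟩
  -- By maximality of `s`, adding any outside index produces a non-zero combination in `K`; these
  -- combinations form the replacement family.
  have key : ∀ i : {i // i ∉ s}, ∃ (a : S) (c : ι → S),
      a • v i + ∑ j ∈ s, c j • v j ∈ K ∧ a • v i + ∑ j ∈ s, c j • v j ≠ 0 := by
    rintro ⟨i, hi⟩
    by_contra! hcon
    have : p (insert i s) := by
      intro c hc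
      rw [Finset.sum_insert hi] at hc ⊢
      exact hcon _ _ hc
    exact hi (hmax this (Finset.subset_insert i s) (Finset.mem_insert_self i s))
  choose a c hK h0 using key
  refine ⟨fun i => a i • v i + ∑ j ∈ s, c i j • v j, hK, h0, ?_⟩
  intro b hb i
  -- The relation `b` among the new elements, rewritten as a relation `e` among the `v j`.
  let e : ι → S := fun j => if hj : j ∈ s then ∑ i, b i * c i j else b ⟨j, hj⟩ * a ⟨j, hj⟩
  have he : ∑ j, e j • v j = 0 := by
    rw [← hb, ← Finset.sum_add_sum_compl s, add_comm]
    simp only [smul_add, Finset.sum_add_distrib, Finset.smul_sum, smul_smul]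
    congr 1
    · rw [Finset.sum_subtype (p := fun i => i ∉ s) sᶜ (by simp)]
      refine Finset.sum_congr rfl fun j _ => ?_
      simp [e, j.2]
    · rw [Finset.sum_comm]
      refine Finset.sum_congr rfl fun j hj => ?_
      simp [e, hj, Finset.sum_smul]
  have h1 : b i • a i • v i = 0 := by
    have := hv e he i
    simpa [e, i.2, smul_smul] using this
  have h2 : b i • (a i • v i + ∑ j ∈ s, c i j • v j) = ∑ j ∈ s, (b i * c i j) • v j := by
    rw [smul_add, h1, zero_add, Finset.smul_sum]
    simp only [smul_smul]
  change b i • (a i • v i + ∑ j ∈ s, c i j • v j) = 0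
  rw [h2]
  exact hs _ (h2 ▸ K.smul_mem _ (hK i))

/-- Subadditivity of the rank along an additive map which is semilinear on `L` for a surjective
map of scalars. -/
theorem RankLE.of_semilinear {T Q : Type*} [Ring T] [AddCommGroup Q] [Module T Q]
    {K L : Submodule S N} {P : Submodule T Q} {a d : ℕ} (f : N →+ Q) (σ : S → T)
    (hσ : Function.Surjective σ) (hf : ∀ s, ∀ y ∈ L, f (s • y) = σ s • f y)
    (hP : ∀ y ∈ L, f y ∈ P) (hker : ∀ y ∈ L, f y = 0 → y ∈ K) (hK : RankLE K a)
    (hd : RankLE P d) : RankLE L (a + d) := by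
  classical
  intro ι _ v hL h0 hv
  obtain ⟨s, hs, w, hw, hw0, hwi⟩ := hv.exists_split K
  have h1 := hK _ w hw hw0 hwi
  have h2 : Fintype.card {i // i ∈ s} ≤ d := by
    refine hd _ (fun i => f (v i)) (fun i => hP _ (hL i)) (fun i hi => ?_) ?_
    · refine h0 i ?_
      have := hs (fun j => if j = i then 1 else 0)
      simp only [ite_smul, one_smul, zero_smul, Finset.sum_ite_eq', i.2, if_true] at this
      exact this (hker _ (hL i) hi)
    · intro c hc i
      -- Surjectivity of `σ` lifts a relation among the images to a combination killed by `f`; it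
      -- lies in `K`, so it vanishes by the choice of `s`.
      choose b hb using fun j : {i // i ∈ s} => hσ (c j)
      let e : ι → S := fun j => if hj : j ∈ s then b ⟨j, hj⟩ else 0
      have hsum : ∑ j ∈ s, e j • v j = ∑ j : {i // i ∈ s}, b j • v j := by
        rw [← Finset.sum_coe_sort s]
        exact Finset.sum_congr rfl fun j _ => by simp [e]
      have hmem : ∑ j ∈ s, e j • v j ∈ L := L.sum_mem fun j _ => L.smul_mem _ (hL j)
      have hz : f (∑ j ∈ s, e j • v j) = 0 := by
        rw [hsum, map_sum, ← hc]
        exact Finset.sum_congr rfl fun j _ => by rw [hf _ _ (hL j), hb]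
      have := hv.sum_finset s e (hs e (hker _ hmem hz)) i i.2
      rw [← hb i, ← hf _ _ (hL i), show b i = e i by simp [e], this, map_zero]
  have h3 := Fintype.card_subtype_compl (fun i => i ∈ s)
  have h4 := Fintype.card_subtype_le (fun i => i ∈ s)
  omega

/-- The quotient map by `K` is injective on `U`, so `RankLE.of_semilinear` applies with the image of
`U` as target. -/
theorem RankLE.sup {K U : Submodule S N} {a d : ℕ} (hKU : Disjoint K U) (hK : RankLE K a)
    (hU : RankLE U d) : RankLE (K ⊔ U) (a + d) := by
  have hinj : ∀ u ∈ U, K.mkQ u = 0 → u = 0 := fun u hu h =>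
    (Submodule.disjoint_def.1 hKU) u (by simpa using h) hu
  refine RankLE.of_semilinear (P := U.map K.mkQ) K.mkQ.toAddMonoidHom id Function.surjective_id
    (fun s y _ => map_smul K.mkQ s y) (fun y hy => ?_) (fun y _ h => by simpa using h) hK ?_
  · obtain ⟨k, hk, u, hu, rfl⟩ := Submodule.mem_sup.1 hy
    refine ⟨u, hu, ?_⟩
    simpa using hk
  · intro ι _ v hv h0 hi
    choose u hu huv using hv
    refine hU ι u hu (fun i h => h0 i (by rw [← huv, h, map_zero])) fun c hc i => ?_
    refine hinj _ (U.smul_mem _ (hu i)) ?_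
    rw [map_smul, huv]
    refine hi c ?_ i
    simp only [← huv, ← map_smul, ← map_sum, hc, map_zero]

theorem IsUniformSubmodule.rankLE {U : Submodule S N} (hU : IsUniformSubmodule U) :
    RankLE U 1 := by
  classical
  intro ι _ v hv h0 hi
  rw [Fintype.card_le_one_iff]
  intro i j
  by_contra hij
  refine hU.2 (Submodule.span S {v i}) (Submodule.span S {v j}) (by simpa using hv i)
    (by simpa using hv j) (by simpa using h0 i) (by simpa using h0 j) ?_
  rw [Submodule.eq_bot_iff]
  rintro y ⟨hyi, hyj⟩
  obtain ⟨a, rfl⟩ := Submodule.mem_span_singleton.1 hyi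
  obtain ⟨b, hb⟩ := Submodule.mem_span_singleton.1 hyj
  have := hi.sum_finset {i, j} (fun l => if l = i then a else -b)
    (by rw [Finset.sum_pair hij]; simp [Ne.symm hij, hb]) i (by simp)
  simpa using this

/-- Each uniform summand contributes at most 1 to the rank of the sum. Essentiality moves any
independent family into the sum by taking non-zero multiples, which stay independent. -/
theorem HasUniformDimension.rankLE {k : ℕ} (hk : HasUniformDimension S N k) :
    RankLE (⊤ : Submodule S N) k := by
  classical
  obtain ⟨U, hU, hind, hess⟩ := hk
  have key : ∀ s : Finset (Fin k), RankLE (⨆ i ∈ s, U i) s.card := by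
    intro s
    induction s using Finset.induction_on with
    | empty =>
      intro ι _ v hv h0 _
      have : IsEmpty ι := ⟨fun i => h0 i (by simpa using hv i)⟩
      simp
    | insert i s hi ih =>
      rw [Finset.iSup_insert, sup_comm, Finset.card_insert_of_notMem hi]
      refine RankLE.sup ?_ ih (hU i).rankLE
      refine ((hind i).mono_right ?_).symm
      exact iSup₂_mono' fun j hj => ⟨j, fun h => hi (h ▸ hj), le_rfl⟩
  intro ι _ v _ h0 hi
  have hex : ∀ i, ∃ c : S, c • v i ∈ ⨆ j, U j ∧ c • v i ≠ 0 := by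
    intro i
    obtain ⟨y, ⟨hy1, hy2⟩, hy0⟩ := Submodule.exists_mem_ne_zero_of_ne_bot (hess (v i) (h0 i))
    obtain ⟨c, rfl⟩ := Submodule.mem_span_singleton.1 hy1
    exact ⟨c, hy2, hy0⟩
  choose c hc hc0 using hex
  have := key Finset.univ ι (fun i => c i • v i) (fun i => by simpa using hc i) hc0 (hi.smul c)
  simpa using this

theorem iSupIndep_span_of_indepElems {ι : Type*} [Fintype ι] {v : ι → N}
    (hv : IndepElems S v) : iSupIndep fun i => Submodule.span S {v i} := by
  classical
  intro i
  rw [Submodule.disjoint_def]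
  intro y hy hy'
  obtain ⟨a, rfl⟩ := Submodule.mem_span_singleton.1 hy
  have hle : (⨆ j, ⨆ (_ : j ≠ i), Submodule.span S {v j}) =
      ⨆ j ∈ Finset.univ.erase i, Submodule.span S {v j} := by simp
  rw [hle, Submodule.mem_iSup_finset_iff_exists_sum] at hy'
  obtain ⟨μ, hμ⟩ := hy'
  choose b hb using fun j => Submodule.mem_span_singleton.1 (μ j).2
  have := hv (fun j => if j = i then a else -b j) (by
    rw [← Finset.add_sum_erase _ _ (Finset.mem_univ i), if_pos rfl, ← hμ,
      ← Finset.sum_add_distrib]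
    refine Finset.sum_eq_zero fun j hj => ?_
    rw [if_neg (Finset.ne_of_mem_erase hj), neg_smul, hb, add_neg_cancel]) i
  simpa using this

theorem IndepElems.option {ι : Type*} [Fintype ι] {v : ι → N} (hv : IndepElems S v) {m : N}
    (hm : ∀ (a : S) (c : ι → S), a • m + ∑ i, c i • v i = 0 → a • m = 0) :
    IndepElems S fun o : Option ι => o.elim m v := by
  intro c hc
  rw [Fintype.sum_option] at hc
  have h1 := hm _ _ hc
  have h2 := hv (fun i => c (some i)) (by simpa [h1] using hc)
  rintro (_ | i)
  exacts [h1, h2 i]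

/-- For the converse, an independent family of the largest possible size `j` cannot be enlarged.
This forces its cyclic submodules to be uniform and their sum to be essential. -/
theorem uniformDimension_le_iff (k : ℕ) :
    uniformDimension S N ≤ k ↔ RankLE (⊤ : Submodule S N) k := by
  classical
  constructor
  · intro hk
    have : ∃ j, HasUniformDimension S N j ∧ j ≤ k := by
      by_contra! hcon
      have : ((k + 1 : ℕ) : ℕ∞) ≤ uniformDimension S N :=
        le_iInf₂ fun j hj => by exact_mod_cast hcon j hj
      have := this.trans hk
      norm_cast at this
      omega
    obtain ⟨j, hj, hjk⟩ := this
    exact hj.rankLE.mono hjk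
  · intro hk
    have hex : ∃ j, RankLE (⊤ : Submodule S N) j := ⟨k, hk⟩
    obtain ⟨j, hj, hjmin⟩ : ∃ j, RankLE (⊤ : Submodule S N) j ∧
        ∀ i < j, ¬ RankLE (⊤ : Submodule S N) i :=
      ⟨Nat.find hex, Nat.find_spec hex, fun i hi => Nat.find_min hex hi⟩
    have hjk : j ≤ k := by
      by_contra! hlt
      exact hjmin k hlt hk
    have hfam : ∃ v : Fin j → N, (∀ i, v i ≠ 0) ∧ IndepElems S v := by
      rcases Nat.eq_zero_or_pos j with rfl | hpos
      · exact ⟨Fin.elim0, fun i => i.elim0, fun _ _ i => i.elim0⟩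
      -- A family violating the bound `j - 1` has exactly `j` members; `j = 0` is treated apart
      -- because of truncated subtraction.
      · have := hjmin (j - 1) (by omega)
        simp only [RankLE] at this
        push Not at this
        obtain ⟨ι, _, v, h1, h2, h3, h4⟩ := this
        have h5 := hj ι v h1 h2 h3
        let e : Fin j ≃ ι := (Fintype.equivFinOfCardEq (by omega)).symm
        refine ⟨v ∘ e, fun i => h2 _, fun c hc i => ?_⟩
        have := h3 (c ∘ e.symm) (by
          rw [← e.sum_comp]
          simpa using hc) (e i)
        simpa using this
    obtain ⟨v, hv0, hv⟩ := hfam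
    have hno : ∀ (w : Fin j → N) (m : N), (∀ i, w i ≠ 0) → m ≠ 0 → IndepElems S w →
        ¬ ∀ (a : S) (c : Fin j → S), a • m + ∑ i, c i • w i = 0 → a • m = 0 := by
      intro w m hw hm hi hcon
      have := hj _ _ (fun _ => trivial) (by rintro (_ | i); exacts [hm, hw i]) (hi.option hcon)
      simp at this
    refine (iInf₂_le j ⟨fun i => Submodule.span S {v i}, fun i => ⟨by simpa using hv0 i, ?_⟩,
      iSupIndep_span_of_indepElems hv, ?_⟩).trans (by exact_mod_cast hjk)
    · intro V W hV hW hV0 hW0 hVW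
      obtain ⟨y, hy, hy0⟩ := Submodule.exists_mem_ne_zero_of_ne_bot hV0
      obtain ⟨z, hz, hz0⟩ := Submodule.exists_mem_ne_zero_of_ne_bot hW0
      obtain ⟨a, rfl⟩ := Submodule.mem_span_singleton.1 (hV hy)
      obtain ⟨b, rfl⟩ := Submodule.mem_span_singleton.1 (hW hz)
      -- Replacing `v i` by `a • v i ∈ V` and adjoining `b • v i ∈ W` would give `j + 1` independent
      -- elements if `V` and `W` met trivially.
      let e : Fin j → S := Function.update 1 i a
      have hei : e i = a := by simp [e]
      refine hno (fun l => e l • v l) (b • v i) (fun l => ?_) hz0 (hv.smul e) fun p c hpc => ?_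
      · by_cases hl : l = i
        · subst hl
          rwa [hei]
        · simpa [e, hl] using hv0 l
      · have hsum := hv (fun l => (if l = i then p * b else 0) + c l * e l) (by
          simpa [add_smul, Finset.sum_add_distrib, ite_smul, mul_smul] using hpc) i
        simp only [if_true, add_smul, mul_smul, hei] at hsum
        have hmem : p • b • v i ∈ V ⊓ W := by
          refine ⟨?_, W.smul_mem _ hz⟩
          rw [eq_neg_of_add_eq_zero_left hsum]
          exact V.neg_mem (V.smul_mem _ hy)
        rwa [hVW, Submodule.mem_bot] at hmem
    · intro m hm hbot
      refine hno v m hv0 hm hv fun a c hac => ?_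
      have hmem : a • m ∈ Submodule.span S {m} ⊓ ⨆ i, Submodule.span S {v i} := by
        refine ⟨Submodule.smul_mem _ _ (Submodule.mem_span_singleton_self m), ?_⟩
        rw [eq_neg_of_add_eq_zero_left hac]
        exact Submodule.neg_mem _ (Submodule.sum_mem _ fun i _ => Submodule.smul_mem _ _
          (Submodule.mem_iSup_of_mem i (Submodule.mem_span_singleton_self _)))
      rwa [hbot, Submodule.mem_bot] at hmem

end IndependentElements

/-! ### Commuting scalars past standard monomials -/

section Commutation

variable {A : Type*} [Ring A] {R : Subring A}

/-- Induction from `y^(a+1) r = y^a σ(r) y + y^a δ(r)`: the leading twist is an iterate of `σ`, and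
all other terms have smaller powers of `y`. -/
theorem exists_pow_mul_sub_mem_span {y : A} {σ δ : R → R}
    (hrel : ∀ r : R, y * (r : A) = (σ r : A) * y + (δ r : A)) (hσ : Function.Surjective σ)
    (a : ℕ) : ∃ τ : R → R, Function.Surjective τ ∧ ∀ r : R,
      y ^ a * (r : A) - (τ r : A) * y ^ a ∈ Submodule.span R ((fun b => y ^ b) '' Set.Iio a) := by
  induction a with
  | zero => exact ⟨id, Function.surjective_id, fun r => by simp⟩
  | succ a ih =>
    obtain ⟨τ, hτ, h⟩ := ih
    refine ⟨τ ∘ σ, hτ.comp hσ, fun r => ?_⟩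
    have hmul : ∀ e ∈ Submodule.span R ((fun b => y ^ b) '' Set.Iio a),
        e * y ∈ Submodule.span R ((fun b => y ^ b) '' Set.Iio (a + 1)) := by
      intro e he
      induction he using Submodule.span_induction with
      | mem e he =>
        obtain ⟨b, hb, rfl⟩ := he
        refine Submodule.subset_span ⟨b + 1, ?_, pow_succ y b⟩
        simpa using hb
      | zero => simp
      | add e e' _ _ h h' => rw [add_mul]; exact add_mem h h'
      | smul c e _ h => rw [smul_mul_assoc]; exact Submodule.smul_mem _ _ h
    have hle : Submodule.span R ((fun b => y ^ b) '' Set.Iio a) ≤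
        Submodule.span R ((fun b => y ^ b) '' Set.Iio (a + 1)) :=
      Submodule.span_mono (Set.image_mono (Set.Iio_subset_Iio (Nat.le_succ a)))
    have hya : (τ (δ r) : A) * y ^ a ∈
        Submodule.span R ((fun b => y ^ b) '' Set.Iio (a + 1)) :=
      Submodule.smul_mem _ (τ (δ r)) (Submodule.subset_span ⟨a, by simp, rfl⟩)
    have := add_mem (add_mem (hmul _ (h (σ r))) (hle (h (δ r)))) hya
    convert this using 1
    rw [pow_succ, mul_assoc, hrel r, Function.comp_apply]
    noncomm_ring

theorem stdMonomial_cons {n : ℕ} (x : Fin (n + 1) → A) (a : ℕ) (β : Fin n → ℕ) :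
    stdMonomial x (Fin.cons a β) = x 0 ^ a * stdMonomial (fun i => x i.succ) β := by
  simp [stdMonomial, List.ofFn_succ]

/-- Moving a scalar leftwards never reorders the variables, so exponents can only drop one variable
at a time. The error terms are therefore below `α` componentwise, not merely in degree. -/
theorem exists_stdMonomial_mul_sub_mem_span {n : ℕ} (x : Fin n → A)
    (hx : ∀ i, ∃ σ δ : R → R, (∀ r : R, x i * (r : A) = (σ r : A) * x i + (δ r : A)) ∧
      Function.Surjective σ) (α : Fin n → ℕ) :
    ∃ τ : R → R, Function.Surjective τ ∧ ∀ r : R,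
      stdMonomial x α * (r : A) - (τ r : A) * stdMonomial x α ∈
        Submodule.span R (stdMonomial x '' Set.Iio α) := by
  induction n with
  | zero => exact ⟨id, Function.surjective_id, fun r => by simp [stdMonomial]⟩
  | succ n ih =>
    obtain ⟨a, α, rfl⟩ : ∃ a β, α = Fin.cons a β := ⟨α 0, Fin.tail α, (Fin.cons_self_tail α).symm⟩
    obtain ⟨τ, hτ, h⟩ := ih (fun i => x i.succ) (fun i => hx i.succ) α
    obtain ⟨σ, δ, hrel, hσ⟩ := hx 0
    have hpow := exists_pow_mul_sub_mem_span hrel hσ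
    set T := Submodule.span R (stdMonomial x '' Set.Iio (Fin.cons a α : Fin (n + 1) → ℕ))
    have hmon : ∀ b β, b ≤ a → β ≤ α → (b < a ∨ β < α) →
        x 0 ^ b * stdMonomial (fun i => x i.succ) β ∈ T := by
      intro b β hb hβ hlt
      refine Submodule.subset_span ⟨Fin.cons b β, Set.mem_Iio.2 (lt_of_le_of_ne ?_ ?_),
        stdMonomial_cons x b β⟩
      · intro i
        refine Fin.cases ?_ (fun i => ?_) i
        · simpa using hb
        · simpa using hβ i
      · intro heq
        obtain ⟨rfl, rfl⟩ := Fin.cons_injective2 heq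
        simp at hlt
    have hlow : ∀ e ∈ Submodule.span R ((fun b => x 0 ^ b) '' Set.Iio a),
        e * stdMonomial (fun i => x i.succ) α ∈ T := by
      intro e he
      induction he using Submodule.span_induction with
      | mem e he =>
        obtain ⟨b, hb, rfl⟩ := he
        exact hmon b α (le_of_lt hb) le_rfl (Or.inl hb)
      | zero => simp
      | add e e' _ _ h h' => rw [add_mul]; exact add_mem h h'
      | smul c e _ h => rw [smul_mul_assoc]; exact Submodule.smul_mem _ _ h
    -- All `b ≤ a` are treated together because moving a coefficient past `x 0 ^ b` creates lower
    -- powers of `x 0`.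
    have htail : ∀ e ∈ Submodule.span R (stdMonomial (fun i => x i.succ) '' Set.Iio α),
        ∀ b ≤ a, x 0 ^ b * e ∈ T := by
      intro e he
      induction he using Submodule.span_induction with
      | mem e he =>
        obtain ⟨β, hβ, rfl⟩ := he
        exact fun b hb => hmon b β hb (le_of_lt hβ) (Or.inr hβ)
      | zero => simp
      | add e e' _ _ h h' => exact fun b hb => by rw [mul_add]; exact add_mem (h b hb) (h' b hb)
      | smul c e _ h =>
        intro b hb
        obtain ⟨ρ, -, hρ⟩ := hpow b
        have hsub : ∀ u ∈ Submodule.span R ((fun b => x 0 ^ b) '' Set.Iio b), u * e ∈ T := by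
          intro u hu
          induction hu using Submodule.span_induction with
          | mem u hu =>
            obtain ⟨b', hb', rfl⟩ := hu
            exact h b' ((le_of_lt hb').trans hb)
          | zero => simp
          | add u u' _ _ h h' => rw [add_mul]; exact add_mem h h'
          | smul c u _ h => rw [smul_mul_assoc]; exact Submodule.smul_mem _ _ h
        have := add_mem (hsub _ (hρ c)) (T.smul_mem (ρ c) (h b hb))
        convert this using 1
        simp only [Subring.smul_def, smul_eq_mul]
        noncomm_ring
    obtain ⟨ρ, hρs, hρ⟩ := hpow a
    refine ⟨ρ ∘ τ, hρs.comp hτ, fun r => ?_⟩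
    have := add_mem (htail _ (h r) a le_rfl) (hlow _ (hρ (τ r)))
    convert this using 1
    rw [stdMonomial_cons, Function.comp_apply]
    noncomm_ring

theorem IsBijectiveSkewPBWExtension.exists_repr_stdMonomial_mul {n : ℕ} {x : Fin n → A}
    (h : IsBijectiveSkewPBWExtension R x) (α : Fin n → ℕ) :
    ∃ τ : R → R, Function.Surjective τ ∧ ∀ (r : R) (β : Fin n → ℕ), ¬ β < α →
      h.basis.repr (stdMonomial x α * (r : A)) β = if β = α then τ r else 0 := by
  have hb : ∀ α, h.basis α = stdMonomial x α := fun α => by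
    simp [IsSkewPBWExtension.basis]
  obtain ⟨τ, hτ, hspan⟩ := exists_stdMonomial_mul_sub_mem_span x (fun i => by
    obtain ⟨σ, δ, hrel, hσ⟩ := h.sigma_bijective i
    exact ⟨σ, δ, hrel, hσ.surjective⟩) α
  refine ⟨τ, hτ, fun r β hβ => ?_⟩
  have hlow : ∀ e ∈ Submodule.span R (stdMonomial x '' Set.Iio α), h.basis.repr e β = 0 := by
    intro e he
    induction he using Submodule.span_induction with
    | mem e he =>
      obtain ⟨γ, hγ, rfl⟩ := he
      rw [← hb, Module.Basis.repr_self, Finsupp.single_apply, if_neg]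
      rintro rfl
      exact hβ hγ
    | zero => simp
    | add e e' _ _ h h' => simp [h, h']
    | smul c e _ h => simp [h]
  have hsplit : stdMonomial x α * (r : A) =
      (stdMonomial x α * (r : A) - (τ r : A) * stdMonomial x α) + τ r • stdMonomial x α := by
    simp [Subring.smul_def]
  rw [hsplit, map_add, Finsupp.add_apply, hlow _ (hspan r), zero_add, map_smul, ← hb,
    Module.Basis.repr_self, Finsupp.smul_apply, Finsupp.single_apply]
  simp [eq_comm]

end Commutation

theorem Finset.exists_forall_rel_of_nonempty {ι : Type*} (r : ι → ι → Prop)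
    [IsLinearOrder ι r] {s : Finset ι} (hs : s.Nonempty) : ∃ m ∈ s, ∀ b ∈ s, r b m := by
  induction hs using Finset.Nonempty.cons_induction with
  | singleton a => exact ⟨a, by simp, fun b hb => by
      rw [Finset.mem_singleton.1 hb]; exact refl_of r a⟩
  | cons a s _ _ ih =>
    obtain ⟨m, hm, hmax⟩ := ih
    rcases total_of r a m with ham | hma
    · refine ⟨m, by simp [hm], fun b hb => ?_⟩
      rcases Finset.mem_cons.1 hb with rfl | hb
      exacts [ham, hmax b hb]
    · refine ⟨a, by simp, fun b hb => ?_⟩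
      rcases Finset.mem_cons.1 hb with rfl | hb
      exacts [refl_of r b, trans_of r (hmax b hb) hma]

/-! ### The induced module as a module over the base ring -/

namespace InducedModule

open MulOpposite

variable {A : Type*} [Ring A] {R : Subring A} {n : ℕ} {x : Fin n → A}

/-- The right `R`-module structure of `M⟨X⟩` obtained by restriction of scalars. -/
noncomputable instance (h : IsSkewPBWExtension R x) (M : Type*) [AddCommGroup M]
    [Module (↥R)ᵐᵒᵖ M] : Module (↥R)ᵐᵒᵖ (InducedModule h M) :=
  Module.compHom _ R.subtype.op

section

variable {h : IsSkewPBWExtension R x} {M : Type*} [AddCommGroup M]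

/-- The coefficient of `x^β`. -/
noncomputable def coeff (β : Fin n → ℕ) : InducedModule h M →+ M :=
  Finsupp.applyAddHom β

theorem ext_coeff {f g : InducedModule h M} (hfg : ∀ β, coeff β f = coeff β g) : f = g :=
  Finsupp.ext hfg

theorem mem_support_iff_coeff {f : InducedModule h M} {β : Fin n → ℕ} :
    β ∈ Finsupp.support f ↔ coeff β f ≠ 0 :=
  Finsupp.mem_support_iff

/-- The constant `m`, as an element of `M⟨X⟩`. -/
noncomputable def const (h : IsSkewPBWExtension R x) (m : M) : InducedModule h M :=
  Finsupp.single 0 m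

theorem const_ne_zero {m : M} (hm : m ≠ 0) : const h m ≠ 0 := by
  intro h0
  exact hm (by simpa using (Finsupp.single_eq_zero.1 h0))

theorem exists_isLeadingMonomial {le : (Fin n → ℕ) → (Fin n → ℕ) → Prop}
    [IsLinearOrder (Fin n → ℕ) le] {f : InducedModule h M} (hf : f ≠ 0) :
    ∃ α, IsLeadingMonomial le f α :=
  Finset.exists_forall_rel_of_nonempty le (Finsupp.support_nonempty_iff.2 hf)

variable [Module (↥R)ᵐᵒᵖ M]

theorem op_coe_smul (r : R) (f : InducedModule h M) : op (r : A) • f = op r • f := rfl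

theorem coeff_op_smul (a : A) (f : InducedModule h M) (β : Fin n → ℕ) :
    coeff β (op a • f) = ∑ α ∈ Finsupp.support f,
      op (h.basis.repr (stdMonomial x α * a) β) • coeff α f := by
  have hsum : mulRight h M a f = Finsupp.sum (show (Fin n → ℕ) →₀ M from f)
      fun α m => tmul h M m (stdMonomial x α * a) := Finsupp.liftAddHom_apply _ _
  change (mulRight h M a f) β = _
  rw [hsum, Finsupp.sum, Finsupp.finsetSum_apply]
  rfl

theorem coeff_smul_const (a : Aᵐᵒᵖ) (m : M) (β : Fin n → ℕ) :
    coeff β (a • const h m) = op (h.basis.repr a.unop β) • m := by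
  change (mulRight h M a.unop (Finsupp.single 0 m)) β = _
  rw [mulRight_single, tmul_apply]
  simp [stdMonomial]

/-- The coefficients of `m a` are the `m r_β`, so a relation over `A` between constants is one
relation over `R` for each `β`. -/
theorem indepElems_const {ι : Type*} [Fintype ι] {v : ι → M} (hv : IndepElems (↥R)ᵐᵒᵖ v) :
    IndepElems Aᵐᵒᵖ fun i => const h (v i) := by
  intro c hc i
  refine ext_coeff fun β => ?_
  rw [coeff_smul_const, map_zero]
  refine hv (fun i => op (h.basis.repr (c i).unop β)) ?_ i
  have := congrArg (coeff β) hc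
  rw [map_sum, map_zero] at this
  rw [← this]
  exact Finset.sum_congr rfl fun i _ => (coeff_smul_const _ _ _).symm

theorem rankLE_of_rankLE_top {d : ℕ} (hd : RankLE (⊤ : Submodule Aᵐᵒᵖ (InducedModule h M)) d) :
    RankLE (⊤ : Submodule (↥R)ᵐᵒᵖ M) d :=
  fun ι _ v _ h0 hi => hd ι (fun i => const h (v i)) (fun _ => trivial)
    (fun i => const_ne_zero (h0 i)) (indepElems_const hi)

variable {le : (Fin n → ℕ) → (Fin n → ℕ) → Prop} [IsLinearOrder (Fin n → ℕ) le]

theorem IsGoodPolynomial.isLeadingMonomial_smul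
    {f : InducedModule h M} (hf : IsGoodPolynomial le f) {α : Fin n → ℕ}
    (hα : IsLeadingMonomial le f α) {r : (↥R)ᵐᵒᵖ} (hr : r • f ≠ 0) :
    IsLeadingMonomial le (r • f) α := by
  obtain ⟨β, hβ, hgood⟩ := hf
  rw [antisymm_of le (hβ.2 α hα.1) (hα.2 β hβ.1)]
  exact hgood r.unop hr

/-- Good polynomials with distinct leading monomials are independent over `R`. -/
theorem indepElems_of_isGoodPolynomial {ι : Type*} [Fintype ι]
    {g : ι → InducedModule h M} {α : ι → Fin n → ℕ}
    (hα : Function.Injective α) (hg : ∀ i, IsGoodPolynomial le (g i))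
    (hlm : ∀ i, IsLeadingMonomial le (g i) (α i)) : IndepElems (↥R)ᵐᵒᵖ g := by
  classical
  intro c hc i
  by_contra hi
  -- The largest leading monomial among the surviving terms occurs in only one of them, so it cannot
  -- cancel.
  obtain ⟨β, hβ, hmax⟩ := Finset.exists_forall_rel_of_nonempty le
    (s := (Finset.univ.filter fun i => c i • g i ≠ 0).image α) ⟨α i, by
      simpa using ⟨i, hi, rfl⟩⟩
  obtain ⟨j, hj, rfl⟩ := Finset.mem_image.1 hβ
  have hj0 := (Finset.mem_filter.1 hj).2
  have hcoef := congrArg (coeff (α j)) hc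
  rw [map_sum, map_zero, Finset.sum_eq_single j] at hcoef
  · exact mem_support_iff_coeff.1 ((hg j).isLeadingMonomial_smul (hlm j) hj0).1 hcoef
  · intro k _ hkj
    by_contra hk
    have hk0 : c k • g k ≠ 0 := fun h0 => hk (by rw [h0, map_zero])
    have h1 := ((hg k).isLeadingMonomial_smul (hlm k) hk0).2 _ (mem_support_iff_coeff.2 hk)
    have h2 := hmax (α k) (Finset.mem_image_of_mem α (Finset.mem_filter.2 ⟨Finset.mem_univ k, hk0⟩))
    exact hkj (hα (antisymm_of le h2 h1))
  · simp

end

section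

variable (h : IsBijectiveSkewPBWExtension R x) {M : Type*} [AddCommGroup M]
  [Module (↥R)ᵐᵒᵖ M]

theorem exists_le_of_mem_support_smul {r : R}
    {f : InducedModule h.toIsSkewPBWExtension M} {β : Fin n → ℕ}
    (hβ : coeff β (op r • f) ≠ 0) : ∃ α, coeff α f ≠ 0 ∧ β ≤ α := by
  rw [← op_coe_smul, coeff_op_smul] at hβ
  obtain ⟨α, hα, h0⟩ := Finset.exists_ne_zero_of_sum_ne_zero hβ
  refine ⟨α, mem_support_iff_coeff.1 hα, ?_⟩
  by_contra hle
  obtain ⟨τ, -, hτ⟩ := h.exists_repr_stdMonomial_mul α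
  rw [hτ r β (fun hlt => hle hlt.le), if_neg (fun heq => hle heq.le)] at h0
  simp at h0

variable (M) in
-- At an exponent with nothing of `f` strictly above it, taking the coefficient is semilinear with a
-- surjective twist, as `RankLE.of_semilinear` requires.
theorem exists_coeff_smul (β : Fin n → ℕ) : ∃ τ : R → R, Function.Surjective τ ∧
      ∀ (r : R) (f : InducedModule h.toIsSkewPBWExtension M),
        (∀ α, coeff α f ≠ 0 → ¬ β < α) → coeff β (op r • f) = op (τ r) • coeff β f := by
  obtain ⟨τ, hτs, hτ⟩ := h.exists_repr_stdMonomial_mul β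
  refine ⟨τ, hτs, fun r f hf => ?_⟩
  rw [← op_coe_smul, coeff_op_smul, Finset.sum_eq_single β]
  · rw [hτ r β (lt_irrefl β), if_pos rfl]
  · intro α hα hne
    obtain ⟨τ', -, hτ'⟩ := h.exists_repr_stdMonomial_mul α
    rw [hτ' r β (hf α (mem_support_iff_coeff.1 hα)), if_neg hne.symm, op_zero, zero_smul]
  · intro hβ
    have : coeff β f = 0 := by
      by_contra h0
      exact hβ (mem_support_iff_coeff.2 h0)
    rw [this, smul_zero]

variable (M) in
/-- The elements of `M⟨X⟩` supported in a set of exponents which is a lower set. -/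
noncomputable def supportedIn (F : Set (Fin n → ℕ)) (hF : IsLowerSet F) :
    Submodule (↥R)ᵐᵒᵖ (InducedModule h.toIsSkewPBWExtension M) where
  carrier := {f | ∀ β, coeff β f ≠ 0 → β ∈ F}
  zero_mem' := fun β hβ => absurd (map_zero _) hβ
  add_mem' := by
    intro f g hf hg β hβ
    by_contra hmem
    refine hβ ?_
    rw [map_add, not_imp_comm.1 (hf β) hmem, not_imp_comm.1 (hg β) hmem, add_zero]
  smul_mem' := by
    intro c f hf β hβ
    obtain ⟨α, hα, hle⟩ := exists_le_of_mem_support_smul h (r := c.unop) hβ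
    exact hF hle (hf α hα)

theorem mem_supportedIn {F : Set (Fin n → ℕ)} {hF : IsLowerSet F}
    {f : InducedModule h.toIsSkewPBWExtension M} :
    f ∈ supportedIn h M F hF ↔ ∀ β, coeff β f ≠ 0 → β ∈ F :=
  Iff.rfl

/-- Remove a maximal exponent `β` of `F`: the coefficient at `β` maps semilinearly to `M`, with
kernel supported in the rest. Each exponent thus adds at most `d`. -/
theorem rankLE_supportedIn {d : ℕ} (hd : RankLE (⊤ : Submodule (↥R)ᵐᵒᵖ M) d)
    (F : Finset (Fin n → ℕ)) (hF : IsLowerSet (F : Set (Fin n → ℕ))) :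
    RankLE (supportedIn h M F hF) (F.card * d) := by
  induction hN : F.card generalizing F with
  | zero =>
    obtain rfl := Finset.card_eq_zero.1 hN
    intro ι _ v hv h0 _
    have : IsEmpty ι := ⟨fun i => h0 i (ext_coeff fun β => by
      rw [map_zero]
      by_contra hne
      simpa using (mem_supportedIn h).1 (hv i) β hne)⟩
    simp
  | succ N ih =>
    obtain ⟨β, hβ, hmax⟩ := F.exists_maximal (Finset.card_pos.1 (by omega))
    have hF' : IsLowerSet ((F.erase β : Finset _) : Set (Fin n → ℕ)) := by
      intro γ ε hεγ hγ
      rw [Finset.mem_coe, Finset.mem_erase] at hγ ⊢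
      refine ⟨?_, hF hεγ hγ.2⟩
      rintro rfl
      exact hγ.1 (le_antisymm (hmax hγ.2 hεγ) hεγ)
    obtain ⟨τ, hτs, hτ⟩ := exists_coeff_smul h M β
    rw [Nat.succ_mul]
    refine RankLE.of_semilinear (coeff β) (fun c => op (τ c.unop)) ?_ ?_ (P := ⊤) (fun _ _ => trivial) ?_
      (ih (F.erase β) hF' (by rw [Finset.card_erase_of_mem hβ, hN]; rfl)) hd
    · intro c
      obtain ⟨r, hr⟩ := hτs c.unop
      exact ⟨op r, by simp [hr]⟩
    · intro c f hf
      exact hτ c.unop f fun α hα hlt => hlt.not_ge (hmax (hf α hα) hlt.le)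
    · intro f hf h0 γ hγ
      rw [Finset.mem_coe, Finset.mem_erase]
      exact ⟨by rintro rfl; exact hγ h0, hf γ hγ⟩

end

/-! ### Good polynomials -/

section

variable (h : IsBijectiveSkewPBWExtension R x) {M : Type*} [AddCommGroup M]
  [Module (↥R)ᵐᵒᵖ M] {le : (Fin n → ℕ) → (Fin n → ℕ) → Prop} [IsLinearOrder (Fin n → ℕ) le]

theorem rel_of_le (hle : ∀ α β : Fin n → ℕ, ∑ i, α i < ∑ i, β i → le α β) {α β : Fin n → ℕ}
    (hαβ : α ≤ β) : le α β := by
  rcases hαβ.eq_or_lt with rfl | hlt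
  · exact refl_of le α
  · obtain ⟨h1, i, hi⟩ := Pi.lt_def.1 hlt
    exact hle _ _ (Finset.sum_lt_sum (fun i _ => h1 i) ⟨i, Finset.mem_univ i, hi⟩)

theorem rel_of_isLeadingMonomial_smul
    (hle : ∀ α β : Fin n → ℕ, ∑ i, α i < ∑ i, β i → le α β)
    {f : InducedModule h.toIsSkewPBWExtension M} {r : R} {α β : Fin n → ℕ}
    (hα : IsLeadingMonomial le f α) (hβ : IsLeadingMonomial le (op r • f) β) : le β α := by
  obtain ⟨ε, hε, hβε⟩ := exists_le_of_mem_support_smul h (mem_support_iff_coeff.1 hβ.1)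
  exact trans_of le (rel_of_le hle hβε) (hα.2 ε (mem_support_iff_coeff.2 hε))

/-- The leading monomials of the multiples `f r` lie in the finite lower set generated by the
support of `f`. A multiple with the smallest one is good, since further multiplication can only
lower it. -/
theorem exists_smul_isGoodPolynomial
    (hle : ∀ α β : Fin n → ℕ, ∑ i, α i < ∑ i, β i → le α β)
    {f : InducedModule h.toIsSkewPBWExtension M} (hf : f ≠ 0) :
    ∃ r : R, op (r : A) • f ≠ 0 ∧ IsGoodPolynomial le (op (r : A) • f) := by
  classical
  let F : Finset (Fin n → ℕ) := (Finsupp.support f).biUnion fun α => Finset.Iic α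
  let s := F.filter fun β => ∃ r : R, IsLeadingMonomial le (op r • f) β
  have hs : ∀ (r : R) (β), IsLeadingMonomial le (op r • f) β → β ∈ s := by
    intro r β hβ
    obtain ⟨ε, hε, hβε⟩ := exists_le_of_mem_support_smul h (mem_support_iff_coeff.1 hβ.1)
    refine Finset.mem_filter.2 ⟨Finset.mem_biUnion.2 ⟨ε, mem_support_iff_coeff.2 hε, ?_⟩, r, hβ⟩
    simpa using hβε
  have hsne : s.Nonempty := by
    obtain ⟨α, hα⟩ := exists_isLeadingMonomial (le := le) hf
    exact ⟨α, hs 1 α (by simpa using hα)⟩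
  have : IsLinearOrder (Fin n → ℕ) (Function.swap le) :=
    { refl := fun a => refl_of le a
      trans := fun a b c hab hbc => trans_of le hbc hab
      antisymm := fun a b hab hba => antisymm_of le hba hab
      total := fun a b => total_of le b a }
  obtain ⟨α, hα, hmin⟩ := Finset.exists_forall_rel_of_nonempty (Function.swap le) hsne
  obtain ⟨r, hr⟩ := (Finset.mem_filter.1 hα).2
  refine ⟨r, ?_, α, hr, fun t ht => ?_⟩
  · intro h0
    have := mem_support_iff_coeff.1 hr.1
    rw [← op_coe_smul, h0, map_zero] at this
    exact this rfl
  · obtain ⟨β, hβ⟩ := exists_isLeadingMonomial (le := le) ht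
    have h1 : le β α := rel_of_isLeadingMonomial_smul h hle hr hβ
    have h2 : le α β := hmin β (hs (r * t) β (by
      rw [op_mul, mul_smul]; exact hβ))
    rwa [antisymm_of le h2 h1]

end

end InducedModule

/-! ### Degree balls in the monoid of exponents -/

section Growth

/-- The exponents of total degree at most `k`. -/
def degreeBall (n k : ℕ) : Finset (Fin n → ℕ) :=
  (Finset.Iic fun _ => k).filter fun α => ∑ i, α i ≤ k

theorem mem_degreeBall {n k : ℕ} {α : Fin n → ℕ} : α ∈ degreeBall n k ↔ ∑ i, α i ≤ k := by
  simp only [degreeBall, Finset.mem_filter, Finset.mem_Iic, and_iff_right_iff_imp]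
  intro hα i
  exact (Finset.single_le_sum (fun _ _ => Nat.zero_le _) (Finset.mem_univ i)).trans hα

theorem isLowerSet_degreeBall (n k : ℕ) : IsLowerSet (degreeBall n k : Set (Fin n → ℕ)) := by
  intro α β hβα hα
  rw [Finset.mem_coe, mem_degreeBall] at hα ⊢
  exact (Finset.sum_le_sum fun i _ => hβα i).trans hα

theorem card_degreeBall_le (n k : ℕ) : (degreeBall n k).card ≤ (k + 1) ^ n := by
  refine (Finset.card_filter_le _ _).trans ?_
  simp [Pi.card_Iic]

theorem card_degreeBall_pos (n k : ℕ) : 0 < (degreeBall n k).card :=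
  Finset.card_pos.2 ⟨0, mem_degreeBall.2 (by simp)⟩

/-- Polynomial growth of the degree balls forces `m ≤ d`. -/
theorem le_of_card_degreeBall {n a m d : ℕ}
    (hcard : ∀ k, m * (degreeBall n k).card ≤ (degreeBall n (k + a)).card * d) : m ≤ d := by
  by_contra! hlt
  have hpos : 0 < d := by
    rcases Nat.eq_zero_or_pos d with rfl | hd
    · have := hcard 0
      have := Nat.mul_pos hlt (card_degreeBall_pos n 0)
      omega
    · exact hd
  have hd' : (0 : ℝ) < d := by exact_mod_cast hpos
  set c : ℝ := m / d
  have hc : 1 < c := by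
    rw [one_lt_div hd']
    exact_mod_cast hlt
  -- If `m > d`, each increase of the radius by `a` multiplies the ball by at least `c > 1`, which
  -- is exponential growth.
  have hgrow : ∀ j : ℕ, c ^ j ≤ (degreeBall n (j * a)).card := by
    intro j
    induction j with
    | zero => simpa using card_degreeBall_pos n 0
    | succ j ih =>
      have h1 : (m : ℝ) * (degreeBall n (j * a)).card ≤ (degreeBall n (j * a + a)).card * d := by
        exact_mod_cast hcard (j * a)
      rw [pow_succ, Nat.succ_mul]
      calc c ^ j * c ≤ (degreeBall n (j * a)).card * c := by gcongr
        _ = m * (degreeBall n (j * a)).card / d := by simp only [c]; ring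
        _ ≤ _ := by rwa [div_le_iff₀ hd']
  -- The constant `a + 2` is chosen so that `j * a + 1 ≤ (a + 2) * j` once `j ≥ 1`.
  have hlim := (tendsto_pow_const_div_const_pow_of_one_lt n hc).const_mul (((a + 2 : ℕ) : ℝ) ^ n)
  rw [mul_zero] at hlim
  obtain ⟨j, hj1, hj⟩ := ((hlim.eventually (gt_mem_nhds one_pos)).and
    (Filter.eventually_ge_atTop 1)).exists
  have hcj : 0 < c ^ j := by positivity
  rw [← mul_div_assoc, div_lt_one hcj, ← mul_pow] at hj1
  have h1 : ((degreeBall n (j * a)).card : ℝ) ≤ (((a + 2 : ℕ) : ℝ) * j) ^ n := by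
    have h2 := card_degreeBall_le n (j * a)
    have h3 : (j * a + 1) ^ n ≤ ((a + 2) * j) ^ n := Nat.pow_le_pow_left (by nlinarith) n
    exact_mod_cast h2.trans h3
  linarith [hgrow j]

end Growth

/-! ### The counting argument and the equality of dimensions -/

namespace InducedModule

open MulOpposite

variable {A : Type*} [Ring A] {R : Subring A} {n : ℕ} {x : Fin n → A}
  (h : IsBijectiveSkewPBWExtension R x) {M : Type*} [AddCommGroup M] [Module (↥R)ᵐᵒᵖ M]
  {le : (Fin n → ℕ) → (Fin n → ℕ) → Prop} [IsLinearOrder (Fin n → ℕ) le]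

theorem degree_le_of_rel (hle : ∀ α β : Fin n → ℕ, ∑ i, α i < ∑ i, β i → le α β)
    {α β : Fin n → ℕ} (hαβ : le α β) : ∑ i, α i ≤ ∑ i, β i := by
  by_contra! hlt
  rw [antisymm_of le hαβ (hle _ _ hlt)] at hlt
  exact lt_irrefl _ hlt

theorem rankLE_top_of_rankLE (hle : ∀ α β : Fin n → ℕ, ∑ i, α i < ∑ i, β i → le α β)
    (hgood : IsGoodSubmodule le (⊤ : Submodule Aᵐᵒᵖ (InducedModule h.toIsSkewPBWExtension M)))
    {d : ℕ} (hd : RankLE (⊤ : Submodule (↥R)ᵐᵒᵖ M) d) :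
    RankLE (⊤ : Submodule Aᵐᵒᵖ (InducedModule h.toIsSkewPBWExtension M)) d := by
  classical
  intro ι _ v _ hv0 hv
  choose r hr0 hrgood using fun i => exists_smul_isGoodPolynomial (le := le) h hle (hv0 i)
  choose α hα using fun i => exists_isLeadingMonomial (le := le) (hr0 i)
  -- The shift `∑ j, α j` is a common multiple of all the leading monomials, so one degree bound
  -- serves every `i`.
  have hex : ∀ (i : ι) (γ : Fin n → ℕ), ∃ a : Aᵐᵒᵖ, IsGoodPolynomial le (a • v i) ∧
      IsLeadingMonomial le (a • v i) ((∑ j, α j) + γ) := by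
    intro i γ
    obtain ⟨g, hg, hg1, hg2⟩ := hgood _ trivial (hrgood i) (α i) (hα i)
      ((∑ j ∈ Finset.univ.erase i, α j) + γ)
    obtain ⟨b, rfl⟩ := Submodule.mem_span_singleton.1 hg
    rw [← add_assoc, Finset.add_sum_erase _ _ (Finset.mem_univ i)] at hg2
    rw [smul_smul] at hg1 hg2
    exact ⟨_, hg1, hg2⟩
  choose a hgd hlm using hex
  refine le_of_card_degreeBall (n := n) (a := ∑ l, (∑ j, α j) l) fun k => ?_
  let K := k + ∑ l, (∑ j, α j) l
  have hrank := rankLE_supportedIn h hd (degreeBall n K) (isLowerSet_degreeBall n K)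
    (ι × {γ // γ ∈ degreeBall n k}) (fun p => a p.1 p.2 • v p.1) ?_ ?_ ?_
  · simpa only [Fintype.card_prod, Fintype.card_coe] using hrank
  · rintro ⟨i, γ, hγ⟩ β hβ
    have h1 := degree_le_of_rel hle ((hlm i γ).2 β (mem_support_iff_coeff.2 hβ))
    simp only [Pi.add_apply, Finset.sum_add_distrib] at h1
    rw [mem_degreeBall] at hγ
    rw [Finset.mem_coe, mem_degreeBall]
    omega
  · rintro ⟨i, γ, hγ⟩ h0
    have := mem_support_iff_coeff.1 (hlm i γ).1
    exact this (by rw [show a i γ • v i = 0 from h0, map_zero])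
  · intro c hc
    -- For fixed `i` the terms add up to an `A`-multiple of `v i`, so independence of `v` separates
    -- the relation by `i`.
    have hsum : ∀ i, ∑ γ : {γ // γ ∈ degreeBall n k}, c (i, γ) • a i γ • v i = 0 := by
      intro i
      have hA : ∀ i, ∑ γ : {γ // γ ∈ degreeBall n k}, c (i, γ) • a i γ • v i =
          (∑ γ : {γ // γ ∈ degreeBall n k}, op ((c (i, γ)).unop : A) * a i γ) • v i := by
        intro i
        rw [Finset.sum_smul]
        exact Finset.sum_congr rfl fun γ _ => by rw [mul_smul, op_coe_smul, op_unop]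
      rw [Fintype.sum_prod_type] at hc
      simp only [hA] at hc ⊢
      exact hv _ hc i
    rintro ⟨i, γ⟩
    exact indepElems_of_isGoodPolynomial (le := le)
      (g := fun γ : {γ // γ ∈ degreeBall n k} => a i γ • v i)
      (α := fun γ => (∑ j, α j) + γ) (fun γ γ' hγ => Subtype.ext (add_left_cancel hγ))
      (fun γ => hgd i γ) (fun γ => hlm i γ) (fun γ => c (i, γ)) (hsum i) γ

end InducedModule

theorem theorem4p9 {A : Type*} [Ring A] (R : Subring A) {n : ℕ} (x : Fin n → A)
    (h : IsBijectiveSkewPBWExtension R x)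
    (M : Type*) [AddCommGroup M] [Module (↥R)ᵐᵒᵖ M]
    (le : (Fin n → ℕ) → (Fin n → ℕ) → Prop) [IsLinearOrder (Fin n → ℕ) le]
    (le_of_degree_lt : ∀ α β : Fin n → ℕ, ∑ i, α i < ∑ i, β i → le α β)
    (hgood : InducedModule.IsGoodSubmodule le
      (⊤ : Submodule Aᵐᵒᵖ (InducedModule h.toIsSkewPBWExtension M))) :
    uniformDimension Aᵐᵒᵖ (InducedModule h.toIsSkewPBWExtension M) =
      uniformDimension (↥R)ᵐᵒᵖ M := by
  have hiff : ∀ k : ℕ, uniformDimension Aᵐᵒᵖ (InducedModule h.toIsSkewPBWExtension M) ≤ k ↔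
      uniformDimension (↥R)ᵐᵒᵖ M ≤ k := fun k => by
    rw [uniformDimension_le_iff, uniformDimension_le_iff]
    exact ⟨InducedModule.rankLE_of_rankLE_top,
      InducedModule.rankLE_top_of_rankLE h le_of_degree_lt hgood⟩
  have hle : ∀ a b : ℕ∞, (∀ k : ℕ, b ≤ k → a ≤ k) → a ≤ b := fun a b hab => by
    induction b using ENat.recTopCoe with
    | top => exact le_top
    | coe b => exact hab b le_rfl
  exact le_antisymm (hle _ _ fun k => (hiff k).2) (hle _ _ fun k => (hiff k).1)
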